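/- Let $d\ge 0$, $K\ge 1$, and let $D=[0,1]^d$ with periodic boundary conditions (the unit torus). For $k=0,\dots,K$ let $\tau_k,\kappa_k^2,\alpha_k>0$ and let $\mu_0^{(k)}$ be the centred Gaussian measure $\mathcal N(0,\tau_k^2A_k^{-\alpha_k})$, $A_k=\kappa_k^2-\Delta$ with periodic boundary conditions on $L_2(D)$, realized as a Borel probability measure on the space $C(D)$ of continuous sample paths with the supremum norm (continuous modification). Let $\mu_0=\bigotimes_{k=0}^K\mu_0^{(k)}$ be the law of $X=(X_0,\dots,X_K)$ on $\Omega=C(D)^{K+1}$, with the norm $\|X\|=\max_k\|X_k\|_\infty$. Assume that $X_0$ is almost surely a Morse function ($C^2$ with nondegenerate Hessian at every critical point) and that $X_0(s)$ has strictly positive variance for every $s\in D$, and that $X_1,\dots,X_K$ are almost surely differentiable. Let $-\infty=c_0<c_1<\dots<c_K=\infty$, and let $m_0,\dots,m_K:D\to\mathbb R$ be measurable mean functions with $|m_k|\le M$ (for instance $m_k=0$). Put $$\log\lambda(s;X)=\sum_{k=1}^K \mathbf 1\{c_{k-1}\le X_0(s)+m_0(s)<c_k\}\,\bigl(X_k(s)+m_k(s)\bigr).$$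 Let $Y$ be a point pattern consisting of $r$ points $s_1,\dots,s_r\in D$ (finite, possibly empty). Divide $D$ into the $N=n_1\cdots n_d$ cells $D_i$ (half-open boxes) of a regular lattice with $n_j\ge1$ cells in direction $j$, let $\tilde s_i$ be the midpoint of $D_i$, $|D_i|$ its volume and $Y_i$ the number of points of $Y$ in $D_i$. Define the potentials of the continuous and of the lattice model by $$\Phi(X;Y)=\int_D\lambda(s;X)\,ds-\sum_{j=1}^r\log\lambda(s_j;X),\qquad \Phi^N(X;Y)=\sum_i\bigl(|D_i|\,\lambda(\tilde s_i;X)-Y_i\log\lambda(\tilde s_i;X)\bigr).$$ Then the posterior measures of both models are well defined. That is, $\Phi(\cdot;Y)$ and $\Phi^N(\cdot;Y)$ are measurable, the normalizing constants $C_\mu(Y)=\int e^{-\Phi(X;Y)}\,d\mu_0(X)$ and $C_{\mu^N}(Y)=\int e^{-\Phi^N(X;Y)}\,d\mu_0(X)$ are finite and strictly positive, and there are unique probability measures $\mu$ and $\mu^N$ on $\Omega$ that are absolutely continuous with respect to $\mu_0$ and have the densities $$\frac{d\mu}{d\mu_0}(X)=\frac{1}{C_\mu(Y)}e^{-\Phi(X;Y)},\qquad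 \frac{d\mu^N}{d\mu_0}(X)=\frac1{C_{\mu^N}(Y)}e^{-\Phi^N(X;Y)}\qquad \mu_0\text{-almost surely.}$$ Moreover, $\Phi(\cdot;Y)$ and $\Phi^N(\cdot;Y)$ are continuous at $\mu_0$-almost every $X\in\Omega$, and they are bounded from below and above in terms of $\|X\|$: for all $X\in\Omega$, both $\Phi(X;Y)$ and $\Phi^N(X;Y)$ lie in the interval $$\bigl[-r(\|X\|+M),\ e^{\|X\|+M}+r(\|X\|+M)\bigr].$$ -/

import Mathlib

open MeasureTheory ProbabilityTheory Filter Topology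

open scoped ENNReal

noncomputable section

namespace LevelSetCox

/-- The observation domain `D = [0,1]^d` with periodic boundary conditions. Its `volume` is Lebesgue
measure on the cube, so that `D` has measure `1`. -/
abbrev Domain (d : ℕ) : Type := UnitAddTorus (Fin d)

/-- The sample paths of one latent field: continuous functions on the domain, with the supremum
norm (the realizations are identified with their continuous modification). -/
abbrev Path (d : ℕ) : Type := C(UnitAddTorus (Fin d), ℝ)

instance instMeasurableSpacePath (d : ℕ) : MeasurableSpace C(UnitAddTorus (Fin d), ℝ) := borel _

instance instBorelSpacePath (d : ℕ) : BorelSpace C(UnitAddTorus (Fin d), ℝ) := ⟨rfl⟩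

/-- The space of all latent fields `X = (X_0, X_1, …, X_K)`, with the product σ-algebra; `X 0` is the
classification (level set) field and `X k.succ` is the field of class `k`. -/
abbrev Fields (d K : ℕ) : Type := Fin (K + 1) → Path d

/-! ### The Gaussian prior -/

/-- The complex Hilbert space `L²(D)`. -/
abbrev L2 (d : ℕ) : Type := Lp ℂ 2 (volume : Measure (UnitAddTorus (Fin d)))

/-- A sample path as an element of `L²(D)`. -/
def toL2 {d : ℕ} (u : Path d) : L2 d :=
  ContinuousMap.toLp (E := ℂ) 2 volume ℂ ((ContinuousMap.mk Complex.ofReal).comp u)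

/-- The eigenvalue `κ² + 4π²|n|²` of `A = κ² - Δ` (periodic boundary conditions on the unit cube)
for the eigenfunction `e_n(s) = exp(2πi n·s)`, `n ∈ ℤ^d`; here `κsq` stands for `κ²`. -/
def eigenvalue {d : ℕ} (κsq : ℝ) (n : Fin d → ℤ) : ℝ :=
  κsq + 4 * Real.pi ^ 2 * ∑ j, (n j : ℝ) ^ 2

/-- `e_n` is an eigenfunction of `A = κ² - Δ` with eigenvalue `κ² + 4π²|n|²`. -/
theorem mFourier_eigen {d : ℕ} (κsq : ℝ) (n : Fin d → ℤ) (s : EuclideanSpace ℝ (Fin d)) :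
    (κsq : ℂ) * UnitAddTorus.mFourier n (fun j => (s j : UnitAddCircle)) -
        Laplacian.laplacian (fun x : EuclideanSpace ℝ (Fin d) =>
          UnitAddTorus.mFourier n (fun j => (x j : UnitAddCircle))) s =
      (eigenvalue κsq n : ℂ) * UnitAddTorus.mFourier n (fun j => (s j : UnitAddCircle)) := by
  set a : Fin d → ℂ := fun j => 2 * Real.pi * Complex.I * n j with ha
  let L : EuclideanSpace ℝ (Fin d) →L[ℝ] ℂ :=
    ∑ j, (a j) • (Complex.ofRealCLM.comp
      (EuclideanSpace.proj j : EuclideanSpace ℝ (Fin d) →L[ℝ] ℝ))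
  have hL : ∀ x, L x = ∑ j, a j * (x j : ℂ) := by
    intro x
    simp [L]
  have hf : (fun x : EuclideanSpace ℝ (Fin d) =>
      UnitAddTorus.mFourier n (fun j => (x j : UnitAddCircle))) =
      fun x => Complex.exp (L x) := by
    funext x
    rw [hL]
    simp only [UnitAddTorus.mFourier, ContinuousMap.coe_mk, Complex.exp_sum]
    refine Finset.prod_congr rfl fun j _ => ?_
    rw [fourier_coe_apply]
    congr 1
    simp [ha]
  have h1 : ∀ x, HasFDerivAt (fun x => Complex.exp (L x)) (Complex.exp (L x) • L) x := fun x =>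
    (L.hasFDerivAt).cexp
  have h2 : fderiv ℝ (fun x => Complex.exp (L x)) = fun x => Complex.exp (L x) • L :=
    funext fun x => (h1 x).fderiv
  have h3 : ∀ x v, fderiv ℝ (fderiv ℝ (fun x => Complex.exp (L x))) x v v =
      Complex.exp (L x) * (L v) ^ 2 := by
    intro x v
    rw [h2, ((h1 x).smul_const L).fderiv]
    simp
    ring
  have h4 : UnitAddTorus.mFourier n (fun j => (s j : UnitAddCircle)) = Complex.exp (L s) :=
    congrFun hf s
  rw [h4, hf, InnerProductSpace.laplacian_eq_iteratedFDeriv_orthonormalBasis _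
    (EuclideanSpace.basisFun (Fin d) ℝ)]
  have h5 : ∀ i, iteratedFDeriv ℝ 2 (fun x => Complex.exp (L x)) s
      ![EuclideanSpace.basisFun (Fin d) ℝ i, EuclideanSpace.basisFun (Fin d) ℝ i] =
      Complex.exp (L s) * (a i) ^ 2 := by
    intro i
    have h7 : L (EuclideanSpace.basisFun (Fin d) ℝ i) = a i := by
      rw [hL, Finset.sum_eq_single i]
      · simp
      · intro j _ hj
        simp [hj]
      · simp
    rw [iteratedFDeriv_two_apply]
    simp only [Matrix.cons_val_zero, Matrix.cons_val_one]
    rw [h3, h7]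
  simp only [h5, ← Finset.mul_sum]
  have h6 : ∑ i, a i ^ 2 = -(4 * Real.pi ^ 2 * ∑ j, (n j : ℂ) ^ 2) := by
    rw [Finset.mul_sum, ← Finset.sum_neg_distrib]
    refine Finset.sum_congr rfl fun j _ => ?_
    simp only [ha]
    ring_nf
    simp
  rw [h6, eigenvalue]
  push_cast
  ring

/-- The eigenfunction `e_n(s) = exp(2πi n·s)` as an element of `L²(D)`. -/
def eigenfunction {d : ℕ} (n : Fin d → ℤ) : L2 d :=
  ContinuousMap.toLp (E := ℂ) 2 volume ℂ (UnitAddTorus.mFourier n)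

/-- The covariance operator `𝒞 = τ² A^{-α}`, `A = κ² - Δ`, on `L²(D)`, that is
`𝒞 f = ∑_n τ² λ_n^{-α} ⟨e_n, f⟩ e_n` for the orthonormal basis of eigenfunctions `e_n` of `A`. -/
def covOp {d : ℕ} (τ κsq α : ℝ) (f : L2 d) : L2 d :=
  ∑' n : Fin d → ℤ, ((τ ^ 2 * eigenvalue κsq n ^ (-α) : ℝ) : ℂ) •
    (inner ℂ (eigenfunction n) f • eigenfunction n)

/-- `ν` is the centred Gaussian measure `𝒩(0, τ² A^{-α})`, `A = κ² - Δ`, on sample paths: it is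
Gaussian, has mean zero, and `E⟨f, u⟩⟨u, g⟩ = ⟨f, 𝒞 g⟩` for all `f, g ∈ L²(D)`. -/
def IsPrior {d : ℕ} (τ κsq α : ℝ) (ν : Measure (Path d)) : Prop :=
  IsGaussian ν ∧ (∫ u, u ∂ν) = 0 ∧
    ∀ f g : L2 d, ∫ u, inner ℂ f (toL2 u) * inner ℂ (toL2 u) g ∂ν = inner ℂ f (covOp τ κsq α g)

/-! ### Morse functions -/

/-- The `ℤ^d`-periodic function on `ℝ^d` that corresponds to a function on the domain. -/
def lift {d : ℕ} (u : Path d) (s : Fin d → ℝ) : ℝ :=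
  u (fun j => (s j : UnitAddCircle))

/-- `u` is a Morse function: it is `C²` and the Hessian at each critical point is nondegenerate. -/
def IsMorse {d : ℕ} (u : Path d) : Prop :=
  ContDiff ℝ 2 (lift u) ∧
    ∀ s, fderiv ℝ (lift u) s = 0 →
      ∀ v, (∀ w, fderiv ℝ (fderiv ℝ (lift u)) s v w = 0) → v = 0

/-- The standing assumption on the priors `ν 0, …, ν K` of the fields: the classification field is
almost surely a Morse function and has strictly positive variance at all locations, and the fields
of the classes are almost surely differentiable. -/
def MorseAssumption {d K : ℕ} (ν : Fin (K + 1) → Measure (Path d)) : Prop :=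
  (∀ᵐ u ∂ν 0, IsMorse u) ∧ (∀ s : Domain d, 0 < Var[fun u : Path d => u s; ν 0]) ∧
    ∀ k : Fin K, ∀ᵐ u ∂ν k.succ, Differentiable ℝ (lift u)

/-! ### The level set Cox process and its likelihood potentials -/

/-- The classification function `π_k`, where class `k` occupies the set of the locations `s` with
`c_{k-1} ≤ X_0(s) + m_0(s) < c_k`. The `K` classes are numbered by `Fin K`, so that the thresholds of
class `k` are `c k.castSucc` and `c k.succ`. -/
def classInd {d K : ℕ} (c : Fin (K + 1) → EReal) (m : Fin (K + 1) → Domain d → ℝ)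
    (X : Fields d K) (k : Fin K) (s : Domain d) : ℝ :=
  Set.indicator {t : Domain d | c k.castSucc ≤ ((X 0 t + m 0 t : ℝ) : EReal) ∧
    ((X 0 t + m 0 t : ℝ) : EReal) < c k.succ} (fun _ => 1) s

/-- The intensity `λ(s; X) = exp (∑_k π_k(s) (X_k(s) + m_k(s)))`. -/
def intensity {d K : ℕ} (c : Fin (K + 1) → EReal) (m : Fin (K + 1) → Domain d → ℝ)
    (X : Fields d K) (s : Domain d) : ℝ :=
  Real.exp (∑ k : Fin K, classInd c m X k s * (X k.succ s + m k.succ s))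

/-- The potential `Φ(X; Y) = ∫_D λ(s; X) ds - ∑_j log λ(s_j; X)` of the continuous model; the
observed point pattern `Y` consists of the points `y 0, …, y (r - 1)`. -/
def potential {d K r : ℕ} (c : Fin (K + 1) → EReal) (m : Fin (K + 1) → Domain d → ℝ)
    (y : Fin r → Domain d) (X : Fields d K) : ℝ :=
  (∫ s : Domain d, intensity c m X s) - ∑ j : Fin r, Real.log (intensity c m X (y j))

/-- The cell `∏_j [i_j / n_j, (i_j + 1) / n_j)` of the regular lattice with `n_j` cells in
direction `j`. -/
def cell {d : ℕ} (n : Fin d → ℕ) (i : ∀ j, Fin (n j)) : Set (Domain d) :=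
  Set.pi Set.univ fun j =>
    (fun t : ℝ => (t : UnitAddCircle)) ''
      Set.Ico (((i j : ℕ) : ℝ) / (n j : ℝ)) ((((i j : ℕ) : ℝ) + 1) / (n j : ℝ))

/-- The midpoint of a cell. -/
def midpoint {d : ℕ} (n : Fin d → ℕ) (i : ∀ j, Fin (n j)) : Domain d :=
  fun j => (((((i j : ℕ) : ℝ) + 1 / 2) / (n j : ℝ) : ℝ) : UnitAddCircle)

/-- The number `Y_i` of observed points in a cell. -/
def count {d r : ℕ} (n : Fin d → ℕ) (y : Fin r → Domain d) (i : ∀ j, Fin (n j)) : ℕ :=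
  Nat.card {l : Fin r // y l ∈ cell n i}

/-- The potential `Φ^N(X; Y) = ∑_i (|D_i| λ(s̃_i; X) - Y_i log λ(s̃_i; X))` of the lattice model with
the `N = ∏_j n_j` cells `D_i` and their midpoints `s̃_i`. -/
def latticePotential {d K r : ℕ} (c : Fin (K + 1) → EReal) (m : Fin (K + 1) → Domain d → ℝ)
    (n : Fin d → ℕ) (y : Fin r → Domain d) (X : Fields d K) : ℝ :=
  ∑ i : (∀ j, Fin (n j)), (volume.real (cell n i) * intensity c m X (midpoint n i) -
    (count n y i : ℝ) * Real.log (intensity c m X (midpoint n i)))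

/-! ### Posterior measures -/

/-- The normalizing constant `C = ∫ exp(-Φ) dμ₀`. -/
def normConst {Ω : Type*} [MeasurableSpace Ω] (μ₀ : Measure Ω) (Φ : Ω → ℝ) : ℝ :=
  ∫ X, Real.exp (-Φ X) ∂μ₀

/-- `μ` is the posterior measure for the prior `μ₀` and the potential `Φ`: a probability measure,
absolutely continuous with respect to `μ₀`, with Radon–Nikodym density `C⁻¹ exp(-Φ)`. -/
def IsPosterior {Ω : Type*} [MeasurableSpace Ω] (μ₀ : Measure Ω) (Φ : Ω → ℝ) (μ : Measure Ω) :
    Prop :=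
  IsProbabilityMeasure μ ∧ μ ≪ μ₀ ∧
    μ.rnDeriv μ₀ =ᵐ[μ₀] fun X => ENNReal.ofReal ((normConst μ₀ Φ)⁻¹ * Real.exp (-Φ X))

/-- The posterior measure for `μ₀` and `Φ` is well defined: `Φ` is measurable, `exp(-Φ)` has a finite
and positive integral, and there is exactly one posterior measure. -/
def PosteriorWellDefined {Ω : Type*} [MeasurableSpace Ω] (μ₀ : Measure Ω) (Φ : Ω → ℝ) : Prop :=
  Measurable Φ ∧ Integrable (fun X => Real.exp (-Φ X)) μ₀ ∧ 0 < normConst μ₀ Φ ∧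
    ∃! μ : Measure Ω, IsPosterior μ₀ Φ μ

end LevelSetCox

end

/-!
Everything rests on one pointwise fact: the classes are disjoint, so `log λ(s; X)` is zero or one of
the values `X_k(s) + m_k(s)`, and hence `|log λ(s; X)| ≤ ‖X‖ + M` (`abs_logIntensity_le`). Since the
torus has volume one, and since the lattice cells are disjoint, so that their volumes add up to at
most one and their counts to at most `r`, this gives the two-sided bounds on both potentials.

The lower bound shows that `exp (-Φ)` is at most `exp (r (‖X‖ + M))`, which is integrable by Fernique's
theorem applied to each Gaussian factor of the prior (`integrable_exp_mul_norm_pi`). Together with the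
joint measurability of `λ(s; X)` in `(X, s)`, this makes the posteriors well defined
(`posteriorWellDefined_of_lower_bound`).

The map `X ↦ λ(s; X)` is continuous at every `X` for which `X_0(s) + m_0(s)` is not a threshold. For a
fixed `s`, the variable `X_0(s)` is Gaussian with positive variance and thus has no atoms, so the
exceptional `X` form a null set. This settles the finitely many observed points and midpoints. By
Fubini's theorem, almost every `X` has a level set of volume zero (`ae_ae_ne_threshold`), and the
integral `∫ λ(s; X) ds` is continuous at such an `X` by dominated convergence.
-/

namespace LevelSetCox

/-! ### Posterior measures from a lower bound on the potential -/

section Posterior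

variable {Ω : Type*} [MeasurableSpace Ω]

/-- The posterior is `μ₀` with density `C⁻¹ exp (-Φ)`; it is unique because a measure that is
absolutely continuous is determined by its Radon–Nikodym derivative. -/
theorem posteriorWellDefined_of_integrable {μ₀ : Measure Ω} [IsProbabilityMeasure μ₀] {Φ : Ω → ℝ}
    (hΦ : Measurable Φ) (hint : Integrable (fun X => Real.exp (-Φ X)) μ₀) :
    PosteriorWellDefined μ₀ Φ := by
  have hpos : 0 < normConst μ₀ Φ := integral_exp_pos hint
  have hmeas : Measurable fun X =>
      ENNReal.ofReal ((normConst μ₀ Φ)⁻¹ * Real.exp (-Φ X)) := by fun_prop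
  refine ⟨hΦ, hint, hpos,
    μ₀.withDensity fun X => ENNReal.ofReal ((normConst μ₀ Φ)⁻¹ * Real.exp (-Φ X)),
    ⟨⟨?_⟩, withDensity_absolutelyContinuous _ _, Measure.rnDeriv_withDensity _ hmeas⟩, ?_⟩
  · rw [withDensity_apply _ MeasurableSet.univ, Measure.restrict_univ,
      ← ofReal_integral_eq_lintegral_ofReal (hint.const_mul _)
        (Eventually.of_forall fun X => by positivity), integral_const_mul]
    change ENNReal.ofReal ((normConst μ₀ Φ)⁻¹ * normConst μ₀ Φ) = 1
    rw [inv_mul_cancel₀ hpos.ne', ENNReal.ofReal_one]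
  · rintro μ ⟨hμ, hac, hd⟩
    rw [← Measure.withDensity_rnDeriv_eq μ μ₀ hac]
    exact withDensity_congr_ae hd

theorem posteriorWellDefined_of_lower_bound {μ₀ : Measure Ω} [IsProbabilityMeasure μ₀]
    {Φ g : Ω → ℝ} (hΦ : Measurable Φ) (hg : Integrable (fun X => Real.exp (g X)) μ₀)
    (hle : ∀ X, -g X ≤ Φ X) : PosteriorWellDefined μ₀ Φ := by
  refine posteriorWellDefined_of_integrable hΦ (hg.mono' (by fun_prop) ?_)
  refine Eventually.of_forall fun X => ?_
  rw [Real.norm_eq_abs, Real.abs_exp, Real.exp_le_exp]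
  linarith [hle X]

end Posterior

/-! ### Exponential moments of Gaussian measures -/

theorem integrable_exp_mul_norm {E : Type*} [NormedAddCommGroup E] [NormedSpace ℝ E]
    [MeasurableSpace E] [BorelSpace E] [SecondCountableTopology E] [CompleteSpace E]
    (μ : Measure E) [IsGaussian μ] (a : ℝ) : Integrable (fun x => Real.exp (a * ‖x‖)) μ := by
  obtain ⟨C, hC, hint⟩ := IsGaussian.exists_integrable_exp_sq μ
  refine (hint.const_mul (Real.exp (a ^ 2 / (4 * C)))).mono'
    (by fun_prop) (Eventually.of_forall fun x => ?_)
  rw [Real.norm_eq_abs, Real.abs_exp, ← Real.exp_add, Real.exp_le_exp]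
  -- complete the square: `C t² - a t + a² / (4 C) = C (t - a / (2 C))²`
  have h : a ^ 2 / (4 * C) + C * ‖x‖ ^ 2 - a * ‖x‖ = C * (‖x‖ - a / (2 * C)) ^ 2 := by
    field_simp
    ring
  have : 0 ≤ C * (‖x‖ - a / (2 * C)) ^ 2 := by positivity
  linarith

theorem integrable_exp_mul_norm_pi {ι E : Type*} [Fintype ι] [NormedAddCommGroup E]
    [NormedSpace ℝ E] [MeasurableSpace E] [BorelSpace E] [SecondCountableTopology E]
    [CompleteSpace E] (ν : ι → Measure E) [∀ k, IsGaussian (ν k)] {a : ℝ} (ha : 0 ≤ a) :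
    Integrable (fun x : ι → E => Real.exp (a * ‖x‖)) (Measure.pi ν) := by
  refine (Integrable.fintype_prod fun k => integrable_exp_mul_norm (ν k) a).mono'
    (by fun_prop) (Eventually.of_forall fun x => ?_)
  rw [Real.norm_eq_abs, Real.abs_exp, ← Real.exp_sum, Real.exp_le_exp, ← Finset.mul_sum]
  refine mul_le_mul_of_nonneg_left ?_ ha
  refine (pi_norm_le_iff_of_nonneg (by positivity)).2 fun k => ?_
  exact Finset.single_le_sum (f := fun k => ‖x k‖) (fun _ _ => norm_nonneg _) (Finset.mem_univ k)

/-! ### The log-intensity -/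

variable {d K r : ℕ} {c : Fin (K + 1) → EReal} {m : Fin (K + 1) → Domain d → ℝ} {M : ℝ}

/-- The logarithm of the intensity, `∑_k π_k(s) (X_k(s) + m_k(s))`. -/
noncomputable def logIntensity (c : Fin (K + 1) → EReal) (m : Fin (K + 1) → Domain d → ℝ)
    (X : Fields d K) (s : Domain d) : ℝ :=
  ∑ k : Fin K, classInd c m X k s * (X k.succ s + m k.succ s)

theorem intensity_eq_exp (X : Fields d K) (s : Domain d) :
    intensity c m X s = Real.exp (logIntensity c m X s) := rfl

theorem log_intensity (X : Fields d K) (s : Domain d) :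
    Real.log (intensity c m X s) = logIntensity c m X s := Real.log_exp _

theorem classInd_eq (X : Fields d K) (k : Fin K) (s : Domain d) :
    classInd c m X k s = (Set.Ico (c k.castSucc) (c k.succ)).indicator (fun _ => 1)
      (((X 0 s + m 0 s : ℝ)) : EReal) := rfl

/-- The classes are disjoint because the thresholds increase. -/
theorem classInd_eq_zero_of_ne (hc : StrictMono c) {X : Fields d K} {s : Domain d} {k l : Fin K}
    (hk : classInd c m X k s ≠ 0) (hl : l ≠ k) : classInd c m X l s = 0 := by
  rw [classInd_eq] at hk ⊢
  have hk := Set.mem_of_indicator_ne_zero hk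
  refine Set.indicator_of_notMem (fun hl' => ?_) _
  rcases lt_or_gt_of_ne hl with h | h
  · have h1 : c l.succ ≤ c k.castSucc := hc.monotone (by
      rw [Fin.le_def]; simp; exact h)
    exact absurd (hl'.2.trans_le h1) hk.1.not_gt
  · have h1 : c k.succ ≤ c l.castSucc := hc.monotone (by
      rw [Fin.le_def]; simp; exact h)
    exact absurd (hk.2.trans_le h1) hl'.1.not_gt

theorem abs_classInd_le (X : Fields d K) (k : Fin K) (s : Domain d) :
    |classInd c m X k s| ≤ 1 := by
  rw [classInd_eq, Set.indicator_apply]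
  split_ifs <;> simp

theorem abs_add_mean_le (hM : ∀ k s, |m k s| ≤ M) (X : Fields d K) (k : Fin (K + 1))
    (s : Domain d) : |X k s + m k s| ≤ ‖X‖ + M := by
  have h1 : |X k s| ≤ ‖X‖ := ((X k).norm_coe_le_norm s).trans (norm_le_pi_norm X k)
  exact (abs_add_le _ _).trans (add_le_add h1 (hM k s))

theorem abs_logIntensity_le (hc : StrictMono c) (hM : ∀ k s, |m k s| ≤ M) (X : Fields d K)
    (s : Domain d) : |logIntensity c m X s| ≤ ‖X‖ + M := by
  have h0 : 0 ≤ ‖X‖ + M := (abs_nonneg _).trans (abs_add_mean_le hM X 0 s)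
  by_cases h : ∃ k, classInd c m X k s ≠ 0
  · obtain ⟨k, hk⟩ := h
    rw [logIntensity, Finset.sum_eq_single k
      (fun l _ hl => by rw [classInd_eq_zero_of_ne hc hk hl, zero_mul]) (by simp), abs_mul]
    calc _ ≤ 1 * (‖X‖ + M) := mul_le_mul (abs_classInd_le X k s) (abs_add_mean_le hM X _ s)
          (abs_nonneg _) zero_le_one
      _ = _ := one_mul _
  · push Not at h
    simpa [logIntensity, h] using h0

theorem intensity_le (hc : StrictMono c) (hM : ∀ k s, |m k s| ≤ M) (X : Fields d K)
    (s : Domain d) : intensity c m X s ≤ Real.exp (‖X‖ + M) :=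
  Real.exp_le_exp.2 ((le_abs_self _).trans (abs_logIntensity_le hc hM X s))

/-! ### Measurability -/

/-- Evaluation is jointly measurable because it is jointly continuous and the domain is second
countable, so that the Borel σ-algebra of the product is the product σ-algebra. -/
theorem measurable_eval (k : Fin (K + 1)) :
    Measurable fun p : Fields d K × Domain d => p.1 k p.2 := by
  have h : Measurable fun p : Path d × Domain d => p.1 p.2 :=
    Continuous.measurable (by fun_prop)
  have hk : Measurable fun p : Fields d K × Domain d => p.1 k :=
    (measurable_pi_apply k).comp measurable_fst
  exact h.comp (hk.prodMk measurable_snd)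

theorem measurable_logIntensity (hm : ∀ k, Measurable (m k)) :
    Measurable fun p : Fields d K × Domain d => logIntensity c m p.1 p.2 := by
  have hX : ∀ k, Measurable fun p : Fields d K × Domain d => p.1 k p.2 + m k p.2 := fun k =>
    (measurable_eval k).add ((hm k).comp measurable_snd)
  refine Finset.measurable_sum _ fun k _ => Measurable.mul ?_ (hX _)
  simp only [classInd_eq]
  exact (measurable_const.indicator measurableSet_Ico).comp (hX 0).coe_real_ereal

theorem measurable_intensity (hm : ∀ k, Measurable (m k)) :
    Measurable fun p : Fields d K × Domain d => intensity c m p.1 p.2 :=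
  Real.measurable_exp.comp (measurable_logIntensity hm)

theorem measurable_intensity_fields (hm : ∀ k, Measurable (m k)) (s : Domain d) :
    Measurable fun X : Fields d K => intensity c m X s := by
  have h : Measurable fun X : Fields d K => (X, s) := measurable_prodMk_right
  have hcomp := (measurable_intensity (c := c) hm).comp h
  exact hcomp

theorem measurable_intensity_domain (hm : ∀ k, Measurable (m k)) (X : Fields d K) :
    Measurable fun s : Domain d => intensity c m X s := by
  have h : Measurable fun s : Domain d => (X, s) := measurable_prodMk_left
  have hcomp := (measurable_intensity (c := c) hm).comp h
  exact hcomp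

theorem measurable_potential (hm : ∀ k, Measurable (m k)) (y : Fin r → Domain d) :
    Measurable (potential (K := K) c m y) := by
  have h : StronglyMeasurable fun p : Fields d K × Domain d => intensity c m p.1 p.2 :=
    (measurable_intensity hm).stronglyMeasurable
  have h1 : Measurable fun X : Fields d K => ∫ s : Domain d, intensity c m X s :=
    h.integral_prod_right'.measurable
  exact h1.sub (Finset.measurable_sum _ fun j _ =>
    Real.measurable_log.comp (measurable_intensity_fields hm (y j)))

theorem measurable_latticePotential (hm : ∀ k, Measurable (m k)) (n : Fin d → ℕ)
    (y : Fin r → Domain d) : Measurable (latticePotential (K := K) c m n y) := by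
  have h : ∀ s, Measurable fun X : Fields d K => intensity c m X s :=
    measurable_intensity_fields hm
  exact Finset.measurable_sum _ fun i _ => ((h _).const_mul _).sub
    ((Real.measurable_log.comp (h _)).const_mul _)

/-! ### The domain and its lattice cells -/

instance isProbabilityMeasure_domain : IsProbabilityMeasure (volume : Measure (Domain d)) :=
  ⟨by rw [← Set.pi_univ Set.univ, volume_pi_pi]; simp⟩

/-- A cell in terms of the representatives in `[0, 1)` of the coordinates. -/
theorem mem_cell_iff {n : Fin d → ℕ} {i : ∀ j, Fin (n j)} {s : Domain d} :
    s ∈ cell n i ↔ ∀ j, (AddCircle.measurableEquivIco 1 0 (s j) : ℝ) ∈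
      Set.Ico (((i j : ℕ) : ℝ) / (n j : ℝ)) ((((i j : ℕ) : ℝ) + 1) / (n j : ℝ)) := by
  simp only [cell, Set.mem_univ_pi]
  refine forall_congr' fun j => ⟨?_, fun h => ⟨_, h, AddCircle.coe_equivIco⟩⟩
  rintro ⟨t, ht, hts⟩
  have hn : (0 : ℝ) < n j := by exact_mod_cast (i j).pos
  have h1 : (((i j : ℕ) : ℝ) + 1) / n j ≤ 1 := by
    rw [div_le_one hn]
    exact_mod_cast (i j).isLt
  have h0 : (0 : ℝ) ≤ ((i j : ℕ) : ℝ) / n j := by positivity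
  have h2 : (AddCircle.measurableEquivIco 1 0 (s j) : ℝ) = t := by
    rw [← hts]
    exact AddCircle.equivIco_coe_of_mem ⟨h0.trans ht.1, by linarith [ht.2]⟩
  rwa [h2]

theorem measurableSet_cell (n : Fin d → ℕ) (i : ∀ j, Fin (n j)) : MeasurableSet (cell n i) := by
  have h : cell n i = ⋂ j, (fun s : Domain d => (AddCircle.measurableEquivIco 1 0 (s j) : ℝ)) ⁻¹'
      Set.Ico (((i j : ℕ) : ℝ) / (n j : ℝ)) ((((i j : ℕ) : ℝ) + 1) / (n j : ℝ)) := by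
    ext s
    simp only [mem_cell_iff, Set.mem_iInter, Set.mem_preimage]
  rw [h]
  exact MeasurableSet.iInter fun j => measurableSet_Ico.preimage
    (measurable_subtype_coe.comp ((MeasurableEquiv.measurable _).comp (measurable_pi_apply j)))

theorem eq_of_mem_cell {n : Fin d → ℕ} {i i' : ∀ j, Fin (n j)} {s : Domain d}
    (h : s ∈ cell n i) (h' : s ∈ cell n i') : i = i' := by
  funext j
  have hn : (0 : ℝ) < n j := by exact_mod_cast (i j).pos
  obtain ⟨h1, h2⟩ := mem_cell_iff.1 h j
  obtain ⟨h3, h4⟩ := mem_cell_iff.1 h' j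
  have h5 := (div_lt_div_iff_of_pos_right hn).1 (h1.trans_lt h4)
  have h6 := (div_lt_div_iff_of_pos_right hn).1 (h3.trans_lt h2)
  norm_cast at h5 h6
  exact Fin.ext (by omega)

theorem sum_volume_cell_le_one (n : Fin d → ℕ) :
    ∑ i : (∀ j, Fin (n j)), volume.real (cell n i) ≤ 1 := by
  have h := sum_measureReal_le_measureReal_univ (μ := (volume : Measure (Domain d)))
    (s := Finset.univ) (t := cell n) (fun i _ => measurableSet_cell n i)
    fun i _ i' _ hne => Set.disjoint_left.2 fun s h h' => hne (eq_of_mem_cell h h')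
  simpa using h

theorem sum_count_le (n : Fin d → ℕ) (y : Fin r → Domain d) :
    ∑ i : (∀ j, Fin (n j)), count n y i ≤ r := by
  have h : Function.Injective fun p : (Σ i : (∀ j, Fin (n j)), {l : Fin r // y l ∈ cell n i}) =>
      (p.2 : Fin r) := by
    rintro ⟨i, l, hl⟩ ⟨i', l', hl'⟩ (rfl : l = l')
    obtain rfl := eq_of_mem_cell hl hl'
    rfl
  simpa only [Nat.card_sigma, Nat.card_fin, count] using Nat.card_le_card_of_injective _ h

/-! ### Bounds on the potentials -/

theorem potential_bounds (hc : StrictMono c) (hm : ∀ k, Measurable (m k))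
    (hM : ∀ k s, |m k s| ≤ M) (y : Fin r → Domain d) (X : Fields d K) :
    -((r : ℝ) * (‖X‖ + M)) ≤ potential c m y X ∧
      potential c m y X ≤ Real.exp (‖X‖ + M) + (r : ℝ) * (‖X‖ + M) := by
  have hint : Integrable (fun s : Domain d => intensity c m X s) :=
    (integrable_const (Real.exp (‖X‖ + M))).mono' (measurable_intensity_domain hm X).aestronglyMeasurable
      (Eventually.of_forall fun s => by
        rw [intensity_eq_exp, Real.norm_eq_abs, Real.abs_exp]
        exact intensity_le hc hM X s)
  have h1 : ∫ s : Domain d, intensity c m X s ≤ Real.exp (‖X‖ + M) := by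
    have h := integral_mono hint (integrable_const _) fun s => intensity_le hc hM X s
    simpa using h
  have h0 : 0 ≤ ∫ s : Domain d, intensity c m X s :=
    integral_nonneg fun s => (Real.exp_pos _).le
  have h2 : |∑ j, Real.log (intensity c m X (y j))| ≤ (r : ℝ) * (‖X‖ + M) := by
    refine (Finset.abs_sum_le_sum_abs _ _).trans ?_
    have h := Finset.sum_le_card_nsmul Finset.univ
      (fun j => |Real.log (intensity c m X (y j))|) (‖X‖ + M)
      fun j _ => by rw [log_intensity]; exact abs_logIntensity_le hc hM X _
    simpa [mul_add] using h
  have h3 := abs_le.1 h2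
  unfold potential
  constructor <;> linarith

theorem latticePotential_bounds (hc : StrictMono c) (hM : ∀ k s, |m k s| ≤ M)
    (n : Fin d → ℕ) (y : Fin r → Domain d) (X : Fields d K) :
    -((r : ℝ) * (‖X‖ + M)) ≤ latticePotential c m n y X ∧
      latticePotential c m n y X ≤ Real.exp (‖X‖ + M) + (r : ℝ) * (‖X‖ + M) := by
  have hX : 0 ≤ ‖X‖ + M := (abs_nonneg _).trans (abs_add_mean_le hM X 0 0)
  have h0 : 0 ≤ ∑ i, volume.real (cell n i) * intensity c m X (midpoint n i) :=
    Finset.sum_nonneg fun i _ => mul_nonneg measureReal_nonneg (Real.exp_pos _).le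
  have h1 : ∑ i, volume.real (cell n i) * intensity c m X (midpoint n i) ≤
      Real.exp (‖X‖ + M) := by
    refine (Finset.sum_le_sum fun i _ => mul_le_mul_of_nonneg_left
      (intensity_le hc hM X (midpoint n i)) measureReal_nonneg).trans ?_
    rw [← Finset.sum_mul]
    exact mul_le_of_le_one_left (Real.exp_pos _).le (sum_volume_cell_le_one n)
  have h2 : |∑ i, (count n y i : ℝ) * Real.log (intensity c m X (midpoint n i))| ≤
      (r : ℝ) * (‖X‖ + M) := by
    have hcount : ∑ i, (count n y i : ℝ) ≤ r := by exact_mod_cast sum_count_le n y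
    refine (Finset.abs_sum_le_sum_abs _ _).trans (le_trans (Finset.sum_le_sum fun i _ => ?_)
      ((Finset.sum_mul _ _ _).symm.trans_le (mul_le_mul_of_nonneg_right hcount hX)))
    rw [abs_mul, Nat.abs_cast, log_intensity]
    exact mul_le_mul_of_nonneg_left (abs_logIntensity_le hc hM X _) (Nat.cast_nonneg _)
  have h3 := abs_le.1 h2
  rw [latticePotential, Finset.sum_sub_distrib]
  constructor <;> linarith

/-! ### Continuity off the level sets -/

theorem continuousAt_indicator_Ico {a b x : EReal} (ha : x ≠ a) (hb : x ≠ b) :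
    ContinuousAt ((Set.Ico a b).indicator fun _ => (1 : ℝ)) x := by
  by_cases hx : x ∈ Set.Ico a b
  · refine (continuousAt_const (y := (1 : ℝ))).congr ?_
    filter_upwards [Ioo_mem_nhds (lt_of_le_of_ne hx.1 ha.symm) hx.2] with t ht
    rw [Set.indicator_of_mem (Set.Ioo_subset_Ico_self ht)]
  · refine (continuousAt_const (y := (0 : ℝ))).congr ?_
    have h : x < a ∨ b < x := by
      by_contra! h
      exact hx ⟨h.1, lt_of_le_of_ne h.2 hb⟩
    rcases h with h | h
    · filter_upwards [Iio_mem_nhds h] with t ht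
      rw [Set.indicator_of_notMem fun h' => h'.1.not_gt ht]
    · filter_upwards [Ioi_mem_nhds h] with t ht
      rw [Set.indicator_of_notMem fun h' => h'.2.not_gt ht]

theorem continuous_add_mean (k : Fin (K + 1)) (s : Domain d) :
    Continuous fun X : Fields d K => X k s + m k s := by
  have h : Continuous fun u : Path d => u s := by fun_prop
  exact (h.comp (continuous_apply k)).add continuous_const

theorem continuousAt_logIntensity {X : Fields d K} {s : Domain d}
    (h : ∀ k, ((X 0 s + m 0 s : ℝ) : EReal) ≠ c k) :
    ContinuousAt (fun X => logIntensity c m X s) X := by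
  refine tendsto_finsetSum _ fun k _ => Tendsto.mul ?_ (continuous_add_mean _ s).continuousAt.tendsto
  have h0 : ContinuousAt (fun X : Fields d K => ((X 0 s + m 0 s : ℝ) : EReal)) X :=
    (continuous_coe_real_ereal.comp (continuous_add_mean 0 s)).continuousAt
  exact ContinuousAt.comp (f := fun X : Fields d K => ((X 0 s + m 0 s : ℝ) : EReal))
    (continuousAt_indicator_Ico (h k.castSucc) (h k.succ)) h0

theorem continuousAt_intensity {X : Fields d K} {s : Domain d}
    (h : ∀ k, ((X 0 s + m 0 s : ℝ) : EReal) ≠ c k) :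
    ContinuousAt (fun X => intensity c m X s) X :=
  (continuousAt_logIntensity h).rexp

theorem continuousAt_potential (hc : StrictMono c) (hm : ∀ k, Measurable (m k))
    (hM : ∀ k s, |m k s| ≤ M) {y : Fin r → Domain d} {X : Fields d K}
    (hy : ∀ j k, ((X 0 (y j) + m 0 (y j) : ℝ) : EReal) ≠ c k)
    (hvol : ∀ᵐ s : Domain d, ∀ k, ((X 0 s + m 0 s : ℝ) : EReal) ≠ c k) :
    ContinuousAt (potential c m y) X := by
  have h1 : ContinuousAt (fun X : Fields d K => ∫ s : Domain d, intensity c m X s) X := by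
    refine continuousAt_of_dominated (bound := fun _ => Real.exp (‖X‖ + 1 + M))
      (Eventually.of_forall fun X' =>
        (measurable_intensity_domain hm X').aestronglyMeasurable) ?_
      (integrable_const _) ?_
    -- the intensity is uniformly bounded on the ball of radius one around `X`
    · have hb : ∀ᶠ X' in 𝓝 X, ‖X'‖ < ‖X‖ + 1 :=
        continuous_norm.continuousAt.eventually_lt_const (lt_add_one _)
      filter_upwards [hb] with X' hX'
      refine Eventually.of_forall fun s => ?_
      rw [intensity_eq_exp, Real.norm_eq_abs, Real.abs_exp, ← intensity_eq_exp]
      exact (intensity_le hc hM X' s).trans (Real.exp_le_exp.2 (by linarith))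
    · filter_upwards [hvol] with s hs using continuousAt_intensity hs
  refine h1.sub (tendsto_finsetSum _ fun j _ => ?_)
  simp only [log_intensity]
  exact continuousAt_logIntensity (hy j)

theorem continuousAt_latticePotential {n : Fin d → ℕ} {y : Fin r → Domain d} {X : Fields d K}
    (h : ∀ i k, ((X 0 (midpoint n i) + m 0 (midpoint n i) : ℝ) : EReal) ≠ c k) :
    ContinuousAt (latticePotential c m n y) X := by
  refine tendsto_finsetSum _ fun i _ => Tendsto.sub
    ((continuousAt_intensity (h i)).tendsto.const_mul _) (Tendsto.const_mul _ ?_)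
  simp only [log_intensity]
  exact continuousAt_logIntensity (h i)

/-! ### Level sets of the Gaussian field are null -/

/-- At a location where the Gaussian field has positive variance, its value has no atoms. -/
theorem ae_eval_ne {ν : Measure (Path d)} [IsGaussian ν] {s : Domain d}
    (hs : 0 < Var[fun u : Path d => u s; ν]) (x : ℝ) : ∀ᵐ u ∂ν, u s ≠ x := by
  have h := IsGaussian.map_eq_gaussianReal (μ := ν) (ContinuousMap.evalCLM ℝ s)
  have hv : Var[(ContinuousMap.evalCLM ℝ s : Path d →L[ℝ] ℝ); ν].toNNReal ≠ 0 := by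
    rw [ne_eq, Real.toNNReal_eq_zero, not_le]
    exact hs
  have : NullSingletonClass (ν.map (ContinuousMap.evalCLM ℝ s : Path d →L[ℝ] ℝ)) := by
    rw [h]
    exact nullSingletonClass_gaussianReal hv
  have hx : ∀ᵐ t ∂(ν.map (ContinuousMap.evalCLM ℝ s : Path d →L[ℝ] ℝ)), t ≠ x := by
    rw [ae_iff]
    simp
  exact ae_of_ae_map (ContinuousLinearMap.measurable _).aemeasurable hx

variable {ν : Fin (K + 1) → Measure (Path d)} [∀ k, IsGaussian (ν k)]

theorem ae_ne_threshold (hvar : ∀ s : Domain d, 0 < Var[fun u : Path d => u s; ν 0])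
    (s : Domain d) :
    ∀ᵐ X ∂(Measure.pi ν), ∀ k, ((X 0 s + m 0 s : ℝ) : EReal) ≠ c k := by
  rw [ae_all_iff]
  intro k
  -- an infinite threshold is never attained, so its junk value under `toReal` is harmless
  have h := (measurePreserving_eval ν 0).quasiMeasurePreserving.ae
    (ae_eval_ne (hvar s) ((c k).toReal - m 0 s))
  filter_upwards [h] with X hX hk
  refine hX ?_
  rw [← hk, EReal.toReal_coe, add_sub_cancel_right]

theorem ae_ae_ne_threshold (hm : Measurable (m 0))
    (hvar : ∀ s : Domain d, 0 < Var[fun u : Path d => u s; ν 0]) :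
    ∀ᵐ X ∂(Measure.pi ν), ∀ᵐ s : Domain d, ∀ k, ((X 0 s + m 0 s : ℝ) : EReal) ≠ c k := by
  have hmeas : Measurable fun p : Fields d K × Domain d =>
      ((p.1 0 p.2 + m 0 p.2 : ℝ) : EReal) :=
    ((measurable_eval 0).add (hm.comp measurable_snd)).coe_real_ereal
  refine (Measure.ae_ae_comm ?_).2 (Eventually.of_forall fun s => ae_ne_threshold hvar s)
  simp only [Set.ofPred_forall]
  exact MeasurableSet.iInter fun k => (hmeas (measurableSet_singleton (c k))).compl

end LevelSetCox

open LevelSetCox in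
theorem mainTheorem3 {d K r : ℕ}
    (τ κsq α : Fin (K + 1) → ℝ) (hτ : ∀ k, 0 < τ k) (hκ : ∀ k, 0 < κsq k) (hα : ∀ k, 0 < α k)
    (ν : Fin (K + 1) → Measure (Path d)) (hν : ∀ k, IsPrior (τ k) (κsq k) (α k) (ν k))
    (hMorse : MorseAssumption ν)
    (c : Fin (K + 1) → EReal) (hc : StrictMono c) (hc_bot : c 0 = ⊥) (hc_top : c (Fin.last K) = ⊤)
    (m : Fin (K + 1) → Domain d → ℝ) (hm : ∀ k, Measurable (m k))
    (M : ℝ) (hM : ∀ k s, |m k s| ≤ M)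
    (y : Fin r → Domain d) (n : Fin d → ℕ) (hn : ∀ j, 0 < n j) :
    (PosteriorWellDefined (Measure.pi ν) (potential c m y) ∧
      PosteriorWellDefined (Measure.pi ν) (latticePotential c m n y)) ∧
    ((∀ᵐ X ∂(Measure.pi ν), ContinuousAt (potential c m y) X) ∧
      ∀ᵐ X ∂(Measure.pi ν), ContinuousAt (latticePotential c m n y) X) ∧
    ∀ X : Fields d K,
      (-((r : ℝ) * (‖X‖ + M)) ≤ potential c m y X ∧
        potential c m y X ≤ Real.exp (‖X‖ + M) + (r : ℝ) * (‖X‖ + M)) ∧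
      (-((r : ℝ) * (‖X‖ + M)) ≤ latticePotential c m n y X ∧
        latticePotential c m n y X ≤ Real.exp (‖X‖ + M) + (r : ℝ) * (‖X‖ + M)) := by
  have hG : ∀ k, IsGaussian (ν k) := fun k => (hν k).1
  have hvar := hMorse.2.1
  have hint : Integrable (fun X : Fields d K => Real.exp ((r : ℝ) * (‖X‖ + M)))
      (Measure.pi ν) := by
    simp only [mul_add, Real.exp_add]
    exact (integrable_exp_mul_norm_pi ν (Nat.cast_nonneg r)).mul_const _
  refine ⟨⟨?_, ?_⟩, ⟨?_, ?_⟩,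
    fun X => ⟨potential_bounds hc hm hM y X, latticePotential_bounds hc hM n y X⟩⟩
  · exact posteriorWellDefined_of_lower_bound (measurable_potential hm y) hint
      fun X => (potential_bounds hc hm hM y X).1
  · exact posteriorWellDefined_of_lower_bound (measurable_latticePotential hm n y) hint
      fun X => (latticePotential_bounds hc hM n y X).1
  · filter_upwards [ae_all_iff.2 fun j => ae_ne_threshold (c := c) (m := m) hvar (y j),
      ae_ae_ne_threshold (c := c) (hm 0) hvar] with X hy hvol
    exact continuousAt_potential hc hm hM hy hvol
  · filter_upwards [ae_all_iff.2 fun i : (∀ j, Fin (n j)) =>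
      ae_ne_threshold (c := c) (m := m) hvar (midpoint n i)] with X h
    exact continuousAt_latticePotential h
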